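/- Let $r$ and $\ell$ be positive integers with $r<\ell$. The (unbalanced) papillon graph $\mathcal{P}_{r,\ell}$ is the simple graph on the $4r+4\ell$ vertices $u_i,v_i$ ($1\le i\le 2r+2\ell$) with the following edges: the edges of the cycle $(u_1,u_2,\ldots,u_{2r+2\ell})$; the edges $u_iv_i$ for $1\le i\le 2r+2\ell$; and the edges $$\{v_{2i-1}v_{2i}: 1\le i\le r+\ell\}\cup\{v_{2i-1}v_{2i+2}: 1\le i\le r+\ell-1,\ i\ne r\}\cup\{v_2v_{2r+2},\ v_{2r-1}v_{2r+2\ell-1}\}.$$ A graph $G$ admitting a perfect matching is PMH if for every perfect matching $M$ of $G$ there exists another perfect matching $N$ of $G$ such that $M\cup N$ is the edge set of a Hamiltonian cycle of $G$. Then $\mathcal{P}_{r,\ell}$ is PMH if and only if $r$ and $\ell$ are both even. Moreover, if at least one of $r$ and $\ell$ is odd, then $\bigcup_{i=1}^{r+\ell}\{u_{2i-1}u_{2i},\,v_{2i-1}v_{2i}\}$ is a perfect matching of $\mathcal{P}_{r,\ell}$ that is not contained in the edge set of any Hamiltonian cycle of $\mathcal{P}_{r,\ell}$. -/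

import Mathlib

/-- The vertices of the papillon graph with parameters `r`, `ℓ`: two copies of
`{1, …, 2r + 2ℓ}`. The vertex `u_i` is `Sum.inl i` and the vertex `v_i` is `Sum.inr i`. -/
abbrev PapillonVertex (r ℓ : ℕ) : Type :=
  (Finset.Icc 1 (2 * r + 2 * ℓ)) ⊕ (Finset.Icc 1 (2 * r + 2 * ℓ))

/-- The list of edges of the papillon graph, each written in one direction. -/
def papillonRel (r ℓ : ℕ) : PapillonVertex r ℓ → PapillonVertex r ℓ → Prop
  | .inl i, .inl j =>
      (j : ℕ) = i + 1 ∨ ((i : ℕ) = 2 * r + 2 * ℓ ∧ (j : ℕ) = 1)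
  | .inl i, .inr j => i = j
  | .inr _, .inl _ => False
  | .inr i, .inr j =>
      (∃ k ∈ Finset.Icc 1 (r + ℓ), (i : ℕ) = 2 * k - 1 ∧ (j : ℕ) = 2 * k) ∨
      (∃ k ∈ Finset.Icc 1 (r + ℓ - 1), k ≠ min r ℓ ∧
        (i : ℕ) = 2 * k - 1 ∧ (j : ℕ) = 2 * k + 2) ∨
      ((i : ℕ) = 2 ∧ (j : ℕ) = 2 * min r ℓ + 2) ∨
      ((i : ℕ) = 2 * min r ℓ - 1 ∧ (j : ℕ) = 2 * r + 2 * ℓ - 1)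

/-- The papillon graph `P_{r,ℓ}` (meant for `1 ≤ r` and `1 ≤ ℓ`). -/
def papillonGraph (r ℓ : ℕ) : SimpleGraph (PapillonVertex r ℓ) :=
  SimpleGraph.fromRel (papillonRel r ℓ)

/-- The edges of the perfect matching `⋃ {u_{2k-1} u_{2k}, v_{2k-1} v_{2k}}`, `1 ≤ k ≤ r + ℓ`,
each written in one direction. -/
def horizontalRel (r ℓ : ℕ) : PapillonVertex r ℓ → PapillonVertex r ℓ → Prop
  | .inl i, .inl j => ∃ k ∈ Finset.Icc 1 (r + ℓ), (i : ℕ) = 2 * k - 1 ∧ (j : ℕ) = 2 * k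
  | .inr i, .inr j => ∃ k ∈ Finset.Icc 1 (r + ℓ), (i : ℕ) = 2 * k - 1 ∧ (j : ℕ) = 2 * k
  | _, _ => False

theorem papillonGraph_adj_of_horizontalRel {r ℓ : ℕ} {x y : PapillonVertex r ℓ}
    (h : horizontalRel r ℓ x y) : (papillonGraph r ℓ).Adj x y := by
  rcases x with i | i <;> rcases y with j | j
  · obtain ⟨k, hk, hi, hj⟩ := h
    rw [Finset.mem_Icc] at hk
    refine ⟨fun e => ?_, Or.inl (Or.inl (by omega))⟩
    have := congrArg Subtype.val (Sum.inl.inj e)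
    omega
  · exact h.elim
  · exact h.elim
  · refine ⟨fun e => ?_, Or.inl (Or.inl h)⟩
    obtain ⟨k, hk, hi, hj⟩ := h
    rw [Finset.mem_Icc] at hk
    have := congrArg Subtype.val (Sum.inr.inj e)
    omega

/-- The spanning subgraph of `P_{r,ℓ}` with edge set
`⋃ {u_{2k-1} u_{2k}, v_{2k-1} v_{2k}}`, `1 ≤ k ≤ r + ℓ`. -/
def horizontalMatching (r ℓ : ℕ) : (papillonGraph r ℓ).Subgraph where
  verts := Set.univ
  Adj x y := horizontalRel r ℓ x y ∨ horizontalRel r ℓ y x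
  adj_sub h := h.elim papillonGraph_adj_of_horizontalRel
    fun h' => (papillonGraph_adj_of_horizontalRel h').symm
  edge_vert _ := Set.mem_univ _
  symm := ⟨fun _ _ h => h.symm⟩

namespace SimpleGraph

variable {V : Type*} [DecidableEq V]

/-- A set of edges is the edge set of a Hamiltonian cycle of `G`. -/
def IsHamiltonianCycleEdgeSet (G : SimpleGraph V) (F : Set (Sym2 V)) : Prop :=
  ∃ (a : V) (p : G.Walk a a), p.IsHamiltonianCycle ∧ {e | e ∈ p.edges} = F

/-- The Perfect-Matching-Hamiltonian property: `G` admits a perfect matching, and for every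
perfect matching `M` there is another perfect matching `N` such that the edges of `M ∪ N` form a
Hamiltonian cycle of `G`. -/
def IsPMH (G : SimpleGraph V) : Prop :=
  (∃ M : G.Subgraph, M.IsPerfectMatching) ∧
    ∀ M : G.Subgraph, M.IsPerfectMatching →
      ∃ N : G.Subgraph, N.IsPerfectMatching ∧ N ≠ M ∧
        G.IsHamiltonianCycleEdgeSet (M.edgeSet ∪ N.edgeSet)

/-- Some Hamiltonian cycle of `G` contains all the edges of `M`. -/
def Subgraph.ExtendsToHamiltonianCycle {G : SimpleGraph V} (M : G.Subgraph) : Prop :=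
  ∃ F : Set (Sym2 V), G.IsHamiltonianCycleEdgeSet F ∧ M.edgeSet ⊆ F

end SimpleGraph

/-! A Hamiltonian cycle through a perfect matching `M` is the union of `M` and a disjoint perfect
matching `N` such that the union is connected. So only connectivity has to be controlled.

The vertices form `r + ℓ` four-cycles, and each corner has exactly one edge leaving its four-cycle.
The four-cycles make up two chains, of lengths `r` and `ℓ`; consecutive ones in a chain are joined
by two edges, and four more edges tie the ends of the chains together. Inside a four-cycle a
matching covers as many of the corners 0, 2 as of the corners 1, 3. Hence the number of leaving
edges used is constant along each chain, and the four tying edges force the same number on both: 2,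
0 or 1 (`IsMatchingCode.trichotomy`).

Disjoint matchings of types 1 and 0 always have a connected union
(`IsMatchingCode.connected_of_one_free`). For types 2 and 0, two strands run along each chain and
are exchanged at each crossing; an odd number of crossings in some chain suffices
(`IsMatchingCode.connected_of_all_free`). This settles types 1 and 2, and type 0 with an odd chain.
A type 0 matching with both crossing counts even gets a type 1 partner, which must change strand
exactly in the four-cycles without a crossing; it closes up when `r` and `ℓ` are even. The
horizontal matching has no crossings at all, so for it this parity condition is also necessary. -/

namespace SimpleGraph

/-! ### Hamiltonian cycles as connected unions of two perfect matchings -/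

variable {V : Type*} [DecidableEq V] {G : SimpleGraph V}

/-- Two disjoint perfect matchings whose union is connected form a Hamiltonian cycle. -/
theorem isHamiltonianCycleEdgeSet_union [Finite V] [Nonempty V] {M N : G.Subgraph}
    (hM : M.IsPerfectMatching) (hN : N.IsPerfectMatching)
    (hMN : ∀ x y, M.Adj x y → ¬ N.Adj x y)
    (hconn : (M.spanningCoe ⊔ N.spanningCoe).Preconnected) :
    G.IsHamiltonianCycleEdgeSet (M.edgeSet ∪ N.edgeSet) := by
  classical
  have := Fintype.ofFinite V
  set K := M.spanningCoe ⊔ N.spanningCoe with hK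
  -- The symmetric difference of two perfect matchings is a union of disjoint cycles; for disjoint
  -- matchings it is their union.
  have hcyc : K.IsCycles := by
    have h := hM.symmDiff_isCycles hN
    have hd : Disjoint M.spanningCoe N.spanningCoe := by
      rw [disjoint_left]
      exact hMN
    rwa [hd.symmDiff_eq_sup] at h
  obtain ⟨v⟩ := ‹Nonempty V›
  obtain ⟨w, hw, -⟩ := hM.1 (hM.2 v)
  obtain ⟨p, hp, hverts⟩ := hcyc.exists_cycle_toSubgraph_verts_eq_connectedComponentSupp
    (c := K.connectedComponentMk v) (v := v) rfl ⟨w, Or.inl hw⟩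
  have hmem : ∀ x, x ∈ p.toSubgraph.verts := fun x => by
    rw [hverts]
    exact ConnectedComponent.sound (hconn x v)
  have hKG : K ≤ G := sup_le M.spanningCoe_le N.spanningCoe_le
  refine ⟨v, p.mapLe hKG, ?_, ?_⟩
  · rw [Walk.isHamiltonianCycle_isCycle_and_isHamiltonian_tail]
    have hc : (p.mapLe hKG).IsCycle := hp.mapLe hKG
    refine ⟨hc, hc.isPath_tail.isHamiltonian_of_mem fun x => ?_⟩
    have hx : x ∈ (p.mapLe hKG).support := by
      simpa using hmem x
    rw [Walk.support_tail_of_not_nil _ hc.not_nil]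
    rw [Walk.mem_support_iff] at hx
    rcases hx with rfl | hx
    · exact Walk.end_mem_tail_support hc.not_nil
    · exact hx
  · ext e
    induction e with | _ x y =>
    have h := hp.adj_toSubgraph_iff_of_isCycles hcyc (hmem x) y
    rw [Walk.adj_toSubgraph_iff_mem_edges] at h
    simp only [Set.mem_ofPred_eq, Walk.edges_mapLe_eq_edges, h, Set.mem_union, Subgraph.mem_edgeSet]
    rfl

/-- A Hamiltonian cycle through a perfect matching `M` is the union of `M` and a second perfect
matching disjoint from `M`, and this union is connected. -/
theorem Subgraph.ExtendsToHamiltonianCycle.exists_isPerfectMatching {M : G.Subgraph}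
    (hM : M.IsPerfectMatching) (h : M.ExtendsToHamiltonianCycle) :
    ∃ N : G.Subgraph, N.IsPerfectMatching ∧ (∀ x y, M.Adj x y → ¬ N.Adj x y) ∧
      (M.spanningCoe ⊔ N.spanningCoe).Preconnected := by
  obtain ⟨F, ⟨a, p, hp, rfl⟩, hMF⟩ := h
  have hMp : ∀ x y, M.Adj x y → p.toSubgraph.Adj x y := fun x y hxy => by
    rw [Walk.adj_toSubgraph_iff_mem_edges]
    exact hMF (Subgraph.mem_edgeSet.2 hxy)
  have hcyc := hp.isCycle.isCycles_spanningCoe_toSubgraph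
  let N : G.Subgraph :=
    { verts := Set.univ
      Adj := fun x y => p.toSubgraph.Adj x y ∧ ¬ M.Adj x y
      adj_sub := fun h => h.1.adj_sub
      edge_vert := fun _ => Set.mem_univ _
      symm := ⟨fun _ _ h => ⟨h.1.symm, fun h' => h.2 h'.symm⟩⟩ }
  refine ⟨N, ?_, fun x y hxy h => h.2 hxy, ?_⟩
  · rw [Subgraph.isPerfectMatching_iff]
    intro v
    obtain ⟨w, hw, hw'⟩ := hM.1 (hM.2 v)
    -- Of the two cycle edges at `v`, one is in `M`; the other is the edge of `N`.
    obtain ⟨z, ⟨hz1, hz2⟩, hz3⟩ := hcyc.existsUnique_ne_adj (v := v) (w := w) (hMp _ _ hw)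
    refine ⟨z, ⟨hz2, fun h => hz1 (hw' z h).symm⟩, fun y hy => hz3 y ⟨?_, hy.1⟩⟩
    rintro rfl
    exact hy.2 hw
  · have hle : p.toSubgraph.spanningCoe ≤ M.spanningCoe ⊔ N.spanningCoe := fun x y hxy => by
      by_cases hxy' : M.Adj x y
      · exact Or.inl hxy'
      · exact Or.inr ⟨hxy, hxy'⟩
    refine fun x y => Reachable.mono hle ?_
    have hx := p.mem_verts_toSubgraph.2 (hp.mem_support x)
    have hy := p.mem_verts_toSubgraph.2 (hp.mem_support y)
    exact (p.toSubgraph_connected ⟨x, hx⟩ ⟨y, hy⟩).map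
      p.toSubgraph.coeEmbeddingSpanningCoe.toHom

end SimpleGraph

/-- A nonempty set of vertices closed under adjacency in a connected graph is everything. -/
theorem SimpleGraph.Preconnected.mem_of_adj_closed {V : Type*} {K : SimpleGraph V}
    (hK : K.Preconnected) {S : V → Prop} (hS : ∀ x y, K.Adj x y → S x → S y) {x : V} (hx : S x) (y : V) : S y := by
  obtain ⟨p⟩ := hK x y
  induction p with
  | nil => exact hx
  | cons h _ ih => exact ih (hS _ _ h hx)

/-! ### Four-cycle coordinates -/

/-- The vertices of a papillon graph split into `r + ℓ` four-cycles
`u_{2k+1} u_{2k+2} v_{2k+2} v_{2k+1}`, `0 ≤ k < r + ℓ`; `papillonCorner r ℓ (c, k)` is the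
corner number `c` of the `k`-th of them (with an arbitrary value for `k ≥ r + ℓ`). -/
def papillonCorner (r ℓ : ℕ) [NeZero r] (x : Fin 4 × ℕ) : PapillonVertex r ℓ :=
  let idx (i : ℕ) : Finset.Icc 1 (2 * r + 2 * ℓ) :=
    if h : i ∈ Finset.Icc 1 (2 * r + 2 * ℓ) then ⟨i, h⟩
    else ⟨1, by have := NeZero.pos r; rw [Finset.mem_Icc]; omega⟩
  match x with
  | (0, k) => .inl (idx (2 * k + 1))
  | (1, k) => .inl (idx (2 * k + 2))
  | (2, k) => .inr (idx (2 * k + 2))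
  | (3, k) => .inr (idx (2 * k + 1))

/-- The inverse of `papillonCorner`. -/
def papillonCode (r ℓ : ℕ) : PapillonVertex r ℓ → Fin 4 × ℕ
  | .inl i => if (i : ℕ) % 2 = 1 then (0, (i - 1) / 2) else (1, (i - 1) / 2)
  | .inr i => if (i : ℕ) % 2 = 1 then (3, (i - 1) / 2) else (2, (i - 1) / 2)

/-- The other end of the edge that leaves the four-cycle of a corner. -/
def papillonExt (r ℓ : ℕ) : Fin 4 × ℕ → Fin 4 × ℕ
  | (0, k) => (1, if k = 0 then r + ℓ - 1 else k - 1)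
  | (1, k) => (0, if k + 1 = r + ℓ then 0 else k + 1)
  | (2, k) => if k = 0 then (2, r) else if k = r then (2, 0) else (3, k - 1)
  | (3, k) => if k + 1 = r then (3, r + ℓ - 1) else if k + 1 = r + ℓ then (3, r - 1) else (2, k + 1)

section

variable {r ℓ : ℕ}

theorem papillonCode_lt (v : PapillonVertex r ℓ) : (papillonCode r ℓ v).2 < r + ℓ := by
  rcases v with ⟨i, hi⟩ | ⟨i, hi⟩ <;> rw [Finset.mem_Icc] at hi <;>
    simp only [papillonCode] <;> split_ifs <;> simp only <;> omega

theorem papillonCorner_code [NeZero r] (v : PapillonVertex r ℓ) :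
    papillonCorner r ℓ (papillonCode r ℓ v) = v := by
  rcases v with ⟨i, hi⟩ | ⟨i, hi⟩ <;> simp only [papillonCode] <;> split_ifs with h <;>
    simp only [papillonCorner] <;> congr 1 <;> rw [Finset.mem_Icc] at hi <;>
    rw [dif_pos (by rw [Finset.mem_Icc]; omega)] <;> exact Subtype.ext (by simp only; omega)

theorem papillonCode_corner [NeZero r] {x : Fin 4 × ℕ} (hx : x.2 < r + ℓ) :
    papillonCode r ℓ (papillonCorner r ℓ x) = x := by
  obtain ⟨c, k⟩ := x
  simp only at hx
  fin_cases c <;> simp only [papillonCorner, Fin.reduceFinMk] <;>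
    rw [dif_pos (by rw [Finset.mem_Icc]; omega)] <;> simp [papillonCode] <;> omega

theorem papillonCorner_inj [NeZero r] {x y : Fin 4 × ℕ} (hx : x.2 < r + ℓ) (hy : y.2 < r + ℓ) :
    papillonCorner r ℓ x = papillonCorner r ℓ y ↔ x = y :=
  ⟨fun h => by rw [← papillonCode_corner hx, h, papillonCode_corner hy], fun h => h ▸ rfl⟩

theorem papillonExt_zero (k : ℕ) :
    papillonExt r ℓ (0, k) = (1, if k = 0 then r + ℓ - 1 else k - 1) := rfl

theorem papillonExt_one (k : ℕ) :
    papillonExt r ℓ (1, k) = (0, if k + 1 = r + ℓ then 0 else k + 1) := rfl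

theorem papillonExt_two (k : ℕ) : papillonExt r ℓ (2, k) =
    if k = 0 then (2, r) else if k = r then (2, 0) else (3, k - 1) := rfl

theorem papillonExt_three (k : ℕ) : papillonExt r ℓ (3, k) =
    if k + 1 = r then (3, r + ℓ - 1) else if k + 1 = r + ℓ then (3, r - 1) else (2, k + 1) := rfl

theorem papillonExt_lt (hr : 0 < r) (hℓ : 0 < ℓ) {x : Fin 4 × ℕ} (hx : x.2 < r + ℓ) :
    (papillonExt r ℓ x).2 < r + ℓ := by
  obtain ⟨c, k⟩ := x
  simp only at hx
  fin_cases c <;> simp only [papillonExt] <;> split_ifs <;> (try simp only) <;> omega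

theorem papillonExt_snd_ne (hr : 0 < r) (hℓ : 0 < ℓ) {x : Fin 4 × ℕ} (hx : x.2 < r + ℓ) :
    (papillonExt r ℓ x).2 ≠ x.2 := by
  obtain ⟨c, k⟩ := x
  simp only at hx
  fin_cases c <;> simp only [papillonExt] <;> split_ifs <;> (try simp only) <;> omega

theorem papillonExt_ext (hr : 0 < r) (hℓ : 0 < ℓ) {x : Fin 4 × ℕ} (hx : x.2 < r + ℓ) :
    papillonExt r ℓ (papillonExt r ℓ x) = x := by
  obtain ⟨c, k⟩ := x
  simp only at hx
  fin_cases c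
  · simp only [Fin.zero_eta, papillonExt_zero, papillonExt_one]
    grind
  · simp only [Fin.mk_one, papillonExt_zero, papillonExt_one]
    grind
  · simp only [Fin.reduceFinMk, papillonExt_two]
    grind [papillonExt_two, papillonExt_three]
  · simp only [Fin.reduceFinMk, papillonExt_three]
    grind [papillonExt_two, papillonExt_three]

theorem papillonRel_inl_inl_iff {i j : Finset.Icc 1 (2 * r + 2 * ℓ)} :
    papillonRel r ℓ (.inl i) (.inl j) ↔
      (j : ℕ) = i + 1 ∨ ((i : ℕ) = 2 * r + 2 * ℓ ∧ (j : ℕ) = 1) := Iff.rfl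

theorem papillonRel_inl_inr_iff {i j : Finset.Icc 1 (2 * r + 2 * ℓ)} :
    papillonRel r ℓ (.inl i) (.inr j) ↔ (i : ℕ) = j := Subtype.ext_iff

theorem papillonRel_inr_inl_iff {i j : Finset.Icc 1 (2 * r + 2 * ℓ)} :
    papillonRel r ℓ (.inr i) (.inl j) ↔ False := Iff.rfl

theorem papillonRel_inr_inr_iff (hrℓ : r < ℓ) {i j : Finset.Icc 1 (2 * r + 2 * ℓ)} :
    papillonRel r ℓ (.inr i) (.inr j) ↔
      ((i : ℕ) % 2 = 1 ∧ (j : ℕ) = i + 1) ∨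
      ((i : ℕ) % 2 = 1 ∧ (j : ℕ) = i + 3 ∧ (i : ℕ) + 1 ≠ 2 * r) ∨
      ((i : ℕ) = 2 ∧ (j : ℕ) = 2 * r + 2) ∨
      ((i : ℕ) = 2 * r - 1 ∧ (j : ℕ) = 2 * r + 2 * ℓ - 1) := by
  obtain ⟨i, hi⟩ := i
  obtain ⟨j, hj⟩ := j
  rw [Finset.mem_Icc] at hi hj
  simp only [papillonRel, min_eq_left hrℓ.le, Finset.mem_Icc]
  refine or_congr ⟨?_, fun h => ⟨(i + 1) / 2, by omega, by omega, by omega⟩⟩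
    (or_congr ⟨?_, fun h => ⟨(i + 1) / 2, by omega, by omega, by omega, by omega⟩⟩ Iff.rfl)
  · rintro ⟨k, hk⟩
    omega
  · rintro ⟨k, hk⟩
    omega

/-- The graph is cubic in these coordinates: two neighbours in the four-cycle, one outside. The
order `u, u, v, v` of the corners makes inner adjacency a shift by one in `Fin 4`. -/
theorem papillonGraph_adj_corner [NeZero r] (hrℓ : r < ℓ) {x y : Fin 4 × ℕ} (hx : x.2 < r + ℓ)
    (hy : y.2 < r + ℓ) :
    (papillonGraph r ℓ).Adj (papillonCorner r ℓ x) (papillonCorner r ℓ y) ↔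
      y = (x.1 + 1, x.2) ∨ y = (x.1 - 1, x.2) ∨ y = papillonExt r ℓ x := by
  have hr := NeZero.pos r
  rw [papillonGraph, SimpleGraph.fromRel_adj, Ne, papillonCorner_inj hx hy]
  obtain ⟨c, k⟩ := x
  obtain ⟨d, j⟩ := y
  simp only at hx hy
  have h1 : 2 * k + 1 ∈ Finset.Icc 1 (2 * r + 2 * ℓ) := by rw [Finset.mem_Icc]; omega
  have h2 : 2 * k + 2 ∈ Finset.Icc 1 (2 * r + 2 * ℓ) := by rw [Finset.mem_Icc]; omega
  have h3 : 2 * j + 1 ∈ Finset.Icc 1 (2 * r + 2 * ℓ) := by rw [Finset.mem_Icc]; omega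
  have h4 : 2 * j + 2 ∈ Finset.Icc 1 (2 * r + 2 * ℓ) := by rw [Finset.mem_Icc]; omega
  fin_cases c <;> fin_cases d <;>
    simp [papillonCorner, papillonExt, dif_pos h1, dif_pos h2,
      dif_pos h3, dif_pos h4, papillonRel_inr_inr_iff hrℓ, papillonRel_inl_inl_iff,
      papillonRel_inl_inr_iff, papillonRel_inr_inl_iff, -Finset.mem_Icc] <;>
    grind

end

/-! ### Perfect matchings as codes -/

/-- Given the set `P` of edges from corner `c` to corner `c + 1` of the four-cycles, a corner is
free if it is on no edge of `P`. -/
def IsFreeCorner (P : Fin 4 → ℕ → Prop) (x : Fin 4 × ℕ) : Prop :=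
  ¬ P x.1 x.2 ∧ ¬ P (x.1 - 1) x.2

/-- `P` is the set of edges inside the four-cycles of a perfect matching of `P_{r,ℓ}`: adjacent
edges are not both in `P`, and the free corners are joined in pairs by the remaining edges. -/
structure IsMatchingCode (r ℓ : ℕ) (P : Fin 4 → ℕ → Prop) : Prop where
  disjoint : ∀ c k, k < r + ℓ → P c k → ¬ P (c + 1) k
  free_ext : ∀ x : Fin 4 × ℕ, x.2 < r + ℓ → IsFreeCorner P x → IsFreeCorner P (papillonExt r ℓ x)

/-- The edges of `M` inside the four-cycles. -/
def matchingCode {r ℓ : ℕ} [NeZero r] (M : (papillonGraph r ℓ).Subgraph) (c : Fin 4) (k : ℕ) :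
    Prop :=
  M.Adj (papillonCorner r ℓ (c, k)) (papillonCorner r ℓ (c + 1, k))

section

variable {r ℓ : ℕ} [NeZero r]

/-- The partner of a corner is one of its three neighbours, and the outer one is distinct from the
inner ones because it lies in another four-cycle. -/
theorem isFreeCorner_matchingCode_iff (hrℓ : r < ℓ) {M : (papillonGraph r ℓ).Subgraph}
    (hM : M.IsPerfectMatching) {x : Fin 4 × ℕ} (hx : x.2 < r + ℓ) :
    IsFreeCorner (matchingCode M) x ↔
      M.Adj (papillonCorner r ℓ x) (papillonCorner r ℓ (papillonExt r ℓ x)) := by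
  have hr := NeZero.pos r
  have hlt := papillonExt_lt hr (hr.trans hrℓ) hx
  have hne := papillonExt_snd_ne hr (hr.trans hrℓ) hx
  obtain ⟨w, hw, hw'⟩ := hM.1 (hM.2 (papillonCorner r ℓ x))
  obtain ⟨c, k⟩ := x
  have hcode : matchingCode M (c - 1) k ↔
      M.Adj (papillonCorner r ℓ (c, k)) (papillonCorner r ℓ (c - 1, k)) := by
    rw [matchingCode, sub_add_cancel, M.adj_comm]
  simp only [IsFreeCorner, hcode]
  constructor
  · rintro ⟨h1, h2⟩
    have hadj := hw.adj_sub
    rw [← papillonCorner_code w, papillonGraph_adj_corner hrℓ hx (papillonCode_lt w)] at hadj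
    rcases hadj with h | h | h
    · rw [← papillonCorner_code w, h] at hw
      exact absurd hw h1
    · rw [← papillonCorner_code w, h] at hw
      exact absurd hw h2
    · rwa [← papillonCorner_code w, h] at hw
  · intro h
    constructor <;> intro h'
    all_goals
      have h2 := (hw' _ h).trans (hw' _ h').symm
      rw [papillonCorner_inj hlt (by exact hx)] at h2
      exact hne (by rw [h2])

theorem isMatchingCode_matchingCode (hrℓ : r < ℓ) {M : (papillonGraph r ℓ).Subgraph}
    (hM : M.IsPerfectMatching) : IsMatchingCode r ℓ (matchingCode M) where
  disjoint c k hk h h' := by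
    have h2 := hM.1.eq_of_adj_left h.symm h'
    rw [papillonCorner_inj hk hk, Prod.mk.injEq] at h2
    revert h2
    fin_cases c <;> simp
  free_ext x hx h := by
    have hr := NeZero.pos r
    rw [isFreeCorner_matchingCode_iff hrℓ hM hx] at h
    rw [isFreeCorner_matchingCode_iff hrℓ hM (papillonExt_lt hr (hr.trans hrℓ) hx),
      papillonExt_ext hr (hr.trans hrℓ) hx]
    exact h.symm

open Classical in
/-- The partner of a corner in the matching with code `P`. -/
noncomputable def codePartner (r ℓ : ℕ) (P : Fin 4 → ℕ → Prop) (x : Fin 4 × ℕ) : Fin 4 × ℕ :=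
  if P x.1 x.2 then (x.1 + 1, x.2)
  else if P (x.1 - 1) x.2 then (x.1 - 1, x.2) else papillonExt r ℓ x

/-- The partner map is an involution sending each vertex to a neighbour, so its pairs form a perfect
matching. -/
theorem IsMatchingCode.exists_isPerfectMatching (hrℓ : r < ℓ) {P : Fin 4 → ℕ → Prop}
    (hP : IsMatchingCode r ℓ P) :
    ∃ N : (papillonGraph r ℓ).Subgraph, N.IsPerfectMatching ∧
      ∀ c k, k < r + ℓ → (matchingCode N c k ↔ P c k) := by
  have hr := NeZero.pos r
  have hℓ := hr.trans hrℓ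
  have hlt : ∀ x : Fin 4 × ℕ, x.2 < r + ℓ → (codePartner r ℓ P x).2 < r + ℓ := fun x hx => by
    unfold codePartner
    split_ifs
    exacts [hx, hx, papillonExt_lt hr hℓ hx]
  have hinv : ∀ x : Fin 4 × ℕ, x.2 < r + ℓ →
      codePartner r ℓ P (codePartner r ℓ P x) = x := fun x hx => by
    by_cases h1 : P x.1 x.2
    · have h2 := hP.disjoint _ _ hx h1
      simp [codePartner, h1, h2]
    · by_cases h2 : P (x.1 - 1) x.2
      · simp [codePartner, h1, h2]
      · have h3 := hP.free_ext x hx ⟨h1, h2⟩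
        have h4 : codePartner r ℓ P x = papillonExt r ℓ x := by simp [codePartner, h1, h2]
        rw [h4, codePartner, if_neg h3.1, if_neg h3.2, papillonExt_ext hr hℓ hx]
  let f : PapillonVertex r ℓ → PapillonVertex r ℓ := fun v =>
    papillonCorner r ℓ (codePartner r ℓ P (papillonCode r ℓ v))
  have hf : ∀ v, f (f v) = v := fun v => by
    simp only [f]
    rw [papillonCode_corner (hlt _ (papillonCode_lt v)), hinv _ (papillonCode_lt v),
      papillonCorner_code]
  have hadj : ∀ v, (papillonGraph r ℓ).Adj v (f v) := fun v => by
    have h := papillonGraph_adj_corner hrℓ (papillonCode_lt v) (hlt _ (papillonCode_lt v))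
    rw [papillonCorner_code] at h
    refine h.2 ?_
    unfold codePartner
    split_ifs <;> simp
  let N : (papillonGraph r ℓ).Subgraph :=
    { verts := Set.univ
      Adj := fun x y => f x = y
      adj_sub := fun {x y} h => h ▸ hadj x
      edge_vert := fun _ => Set.mem_univ _
      symm := ⟨fun x y h => h ▸ hf x⟩ }
  refine ⟨N, ⟨fun v _ => ⟨f v, rfl, fun y (hy : f v = y) => hy.symm⟩, fun v => Set.mem_univ v⟩,
    fun c k hk => ?_⟩
  change f (papillonCorner r ℓ (c, k)) = papillonCorner r ℓ (c + 1, k) ↔ P c k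
  simp only [f]
  rw [papillonCode_corner hk, papillonCorner_inj (hlt _ hk) hk, codePartner]
  split_ifs with h1 h2
  · simp [h1]
  · simp only [Prod.mk.injEq, and_true, h1, iff_false]
    clear h1 h2
    revert c
    decide
  · simp only [h1, iff_false]
    exact fun h => papillonExt_snd_ne hr hℓ (x := (c, k)) hk (by rw [h])

theorem isFreeCorner_congr {n : ℕ} {P Q : Fin 4 → ℕ → Prop}
    (h : ∀ c k, k < n → (P c k ↔ Q c k)) {x : Fin 4 × ℕ} (hx : x.2 < n) :
    IsFreeCorner P x ↔ IsFreeCorner Q x := by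
  simp only [IsFreeCorner, h _ _ hx]

theorem not_adj_of_matchingCode (hrℓ : r < ℓ) {M N : (papillonGraph r ℓ).Subgraph}
    (hM : M.IsPerfectMatching) (hN : N.IsPerfectMatching)
    (hint : ∀ c k, k < r + ℓ → matchingCode M c k → ¬ matchingCode N c k)
    (hext : ∀ x : Fin 4 × ℕ, x.2 < r + ℓ → IsFreeCorner (matchingCode M) x →
      ¬ IsFreeCorner (matchingCode N) x) (v w : PapillonVertex r ℓ) (h : M.Adj v w) :
    ¬ N.Adj v w := by
  have hadj := h.adj_sub
  have hv := papillonCode_lt v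
  have hw := papillonCode_lt w
  rw [← papillonCorner_code v, ← papillonCorner_code w] at h hadj ⊢
  rw [papillonGraph_adj_corner hrℓ hv hw] at hadj
  generalize papillonCode r ℓ v = x at *
  obtain ⟨c, k⟩ := x
  rcases hadj with h1 | h1 | h1 <;> rw [h1] at h ⊢
  · exact hint c k hv h
  · intro h'
    refine hint (c - 1) k hv ?_ ?_ <;> rw [matchingCode, sub_add_cancel]
    exacts [h.symm, h'.symm]
  · rw [← isFreeCorner_matchingCode_iff hrℓ hM hv] at h
    rw [← isFreeCorner_matchingCode_iff hrℓ hN hv]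
    exact hext _ hv h

/-- The union of two perfect matchings is connected if every function on the corners that is
constant along the edges of both is constant. -/
theorem preconnected_of_matchingCode (hrℓ : r < ℓ) {M N : (papillonGraph r ℓ).Subgraph}
    (hM : M.IsPerfectMatching) (hN : N.IsPerfectMatching)
    (h : ∀ (γ : Type) (q : Fin 4 × ℕ → γ),
      (∀ c k, k < r + ℓ → matchingCode M c k ∨ matchingCode N c k → q (c, k) = q (c + 1, k)) →
      (∀ x : Fin 4 × ℕ, x.2 < r + ℓ →
        IsFreeCorner (matchingCode M) x ∨ IsFreeCorner (matchingCode N) x →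
        q x = q (papillonExt r ℓ x)) →
      ∀ x : Fin 4 × ℕ, x.2 < r + ℓ → q x = q (0, 0)) :
    (M.spanningCoe ⊔ N.spanningCoe).Preconnected := by
  intro v w
  set K := M.spanningCoe ⊔ N.spanningCoe with hK
  -- The test function sends a corner to its connected component.
  have h := h K.ConnectedComponent (fun x => K.connectedComponentMk (papillonCorner r ℓ x)) ?_ ?_
  · have h2 := (h _ (papillonCode_lt v)).trans (h _ (papillonCode_lt w)).symm
    simp only [papillonCorner_code] at h2
    exact SimpleGraph.ConnectedComponent.exact h2
  · intro c k hk hc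
    exact SimpleGraph.ConnectedComponent.sound (SimpleGraph.Adj.reachable hc)
  · intro x hx hc
    rw [isFreeCorner_matchingCode_iff hrℓ hM hx, isFreeCorner_matchingCode_iff hrℓ hN hx] at hc
    exact SimpleGraph.ConnectedComponent.sound (SimpleGraph.Adj.reachable hc)

end

/-! ### Free corners along the chains -/

section

variable {r ℓ : ℕ} {P Q : Fin 4 → ℕ → Prop}

theorem isFreeCorner_zero {k : ℕ} : IsFreeCorner P (0, k) ↔ ¬ P 0 k ∧ ¬ P 3 k := Iff.rfl

theorem isFreeCorner_one {k : ℕ} : IsFreeCorner P (1, k) ↔ ¬ P 1 k ∧ ¬ P 0 k := Iff.rfl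

theorem isFreeCorner_two {k : ℕ} : IsFreeCorner P (2, k) ↔ ¬ P 2 k ∧ ¬ P 1 k := Iff.rfl

theorem isFreeCorner_three {k : ℕ} : IsFreeCorner P (3, k) ↔ ¬ P 3 k ∧ ¬ P 2 k := Iff.rfl

theorem IsMatchingCode.not_adjacent (hP : IsMatchingCode r ℓ P) {k : ℕ} (hk : k < r + ℓ) :
    ¬ (P 0 k ∧ P 1 k) ∧ ¬ (P 1 k ∧ P 2 k) ∧ ¬ (P 2 k ∧ P 3 k) ∧ ¬ (P 3 k ∧ P 0 k) :=
  ⟨fun h => hP.disjoint 0 k hk h.1 h.2, fun h => hP.disjoint 1 k hk h.1 h.2,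
    fun h => hP.disjoint 2 k hk h.1 h.2, fun h => hP.disjoint 3 k hk h.1 h.2⟩

/-- In each four-cycle, as many of the corners `0`, `2` are free as of the corners `1`, `3`. -/
theorem IsMatchingCode.free_balance (hP : IsMatchingCode r ℓ P) {k : ℕ} (hk : k < r + ℓ) :
    (IsFreeCorner P (0, k) ∧ IsFreeCorner P (2, k) ↔
      IsFreeCorner P (1, k) ∧ IsFreeCorner P (3, k)) ∧
    (IsFreeCorner P (0, k) ∨ IsFreeCorner P (2, k) ↔
      IsFreeCorner P (1, k) ∨ IsFreeCorner P (3, k)) := by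
  -- Each inner edge joins one of the corners 0, 2 to one of 1, 3. Equality of the two counts, each
  -- at most 2, is expressed by comparing "both" and "at least one".
  have h := hP.not_adjacent hk
  simp only [isFreeCorner_zero, isFreeCorner_one, isFreeCorner_two, isFreeCorner_three]
  tauto

theorem IsMatchingCode.free_ext_iff (hr : 0 < r) (hℓ : 0 < ℓ) (hP : IsMatchingCode r ℓ P)
    {x : Fin 4 × ℕ} (hx : x.2 < r + ℓ) :
    IsFreeCorner P (papillonExt r ℓ x) ↔ IsFreeCorner P x :=
  ⟨fun h => by
    have h2 := hP.free_ext _ (papillonExt_lt hr hℓ hx) h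
    rwa [papillonExt_ext hr hℓ hx] at h2, hP.free_ext x hx⟩

theorem papillonExt_one_of_lt {k : ℕ} (hk : k + 1 < r + ℓ) :
    papillonExt r ℓ (1, k) = (0, k + 1) := by
  rw [papillonExt_one, if_neg hk.ne]

theorem papillonExt_one_last (hr : 0 < r) : papillonExt r ℓ (1, r + ℓ - 1) = (0, 0) := by
  rw [papillonExt_one, if_pos (by omega)]

theorem papillonExt_three_of_lt {k : ℕ} (hk : k + 1 < r + ℓ) (hkr : k + 1 ≠ r) :
    papillonExt r ℓ (3, k) = (2, k + 1) := by
  rw [papillonExt_three, if_neg hkr, if_neg hk.ne]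

theorem papillonExt_three_mid (hr : 0 < r) : papillonExt r ℓ (3, r - 1) = (3, r + ℓ - 1) := by
  rw [papillonExt_three, if_pos (by omega)]

theorem papillonExt_two_first : papillonExt r ℓ (2, 0) = (2, r) := by
  rw [papillonExt_two, if_pos rfl]

/-- The number of free corners among `0`, `2` is constant along each of the two chains. -/
theorem IsMatchingCode.free_chain (hr : 0 < r) (hℓ : 0 < ℓ) (hP : IsMatchingCode r ℓ P)
    {i k : ℕ} (hik : i ≤ k) (hk : k < r + ℓ) (hchain : k < r ∨ r ≤ i) :
    (IsFreeCorner P (0, k) ∧ IsFreeCorner P (2, k) ↔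
      IsFreeCorner P (0, i) ∧ IsFreeCorner P (2, i)) ∧
    (IsFreeCorner P (0, k) ∨ IsFreeCorner P (2, k) ↔
      IsFreeCorner P (0, i) ∨ IsFreeCorner P (2, i)) := by
  induction k, hik using Nat.le_induction with
  | base => exact ⟨Iff.rfl, Iff.rfl⟩
  | succ k hik ih =>
    have hb := hP.free_balance (k := k) (by omega)
    -- Balance moves the count from corners 0, 2 to corners 1, 3; the leaving edges carry it on to
    -- the next four-cycle. The chain condition excludes `k + 1 = r`, where corner 3 is wired
    -- differently.
    have h1 := hP.free_ext_iff hr hℓ (x := (1, k)) (by simp only; omega)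
    have h3 := hP.free_ext_iff hr hℓ (x := (3, k)) (by simp only; omega)
    rw [papillonExt_one_of_lt hk] at h1
    rw [papillonExt_three_of_lt hk (by omega)] at h3
    rw [h1, h3, ← hb.1, ← hb.2]
    exact ih (by omega) (by omega)

/-- A perfect matching uses all, none, or one edge of each of the pairs of edges between
consecutive four-cycles. -/
theorem IsMatchingCode.trichotomy (hr : 0 < r) (hℓ : 0 < ℓ) (hP : IsMatchingCode r ℓ P) :
    (∀ x : Fin 4 × ℕ, x.2 < r + ℓ → IsFreeCorner P x) ∨
    (∀ x : Fin 4 × ℕ, x.2 < r + ℓ → ¬ IsFreeCorner P x) ∨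
    ((∀ k, k < r + ℓ → (IsFreeCorner P (2, k) ↔ ¬ IsFreeCorner P (0, k)) ∧
        (IsFreeCorner P (3, k) ↔ ¬ IsFreeCorner P (1, k))) ∧
      (IsFreeCorner P (0, r) ↔ IsFreeCorner P (0, 0))) := by
  have hmid := hP.free_chain hr hℓ (i := 0) (k := r - 1) (by omega) (by omega) (by omega)
  have hlast := hP.free_chain hr hℓ (i := r) (k := r + ℓ - 1) (by omega) (by omega) (by omega)
  have hbmid := hP.free_balance (k := r - 1) (by omega)
  have hblast := hP.free_balance (k := r + ℓ - 1) (by omega)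
  have h1 := hP.free_ext_iff hr hℓ (x := (1, r - 1)) (by simp only; omega)
  have h2 := hP.free_ext_iff hr hℓ (x := (1, r + ℓ - 1)) (by simp only; omega)
  have h3 := hP.free_ext_iff hr hℓ (x := (3, r - 1)) (by simp only; omega)
  have h4 := hP.free_ext_iff hr hℓ (x := (2, 0)) (by simp only; omega)
  rw [papillonExt_one_of_lt (by omega), Nat.sub_add_cancel hr] at h1
  rw [papillonExt_one_last hr] at h2
  rw [papillonExt_three_mid hr] at h3
  rw [papillonExt_two_first] at h4
  -- With 0-1 values `a`, `a'`, `b`, `d` for freeness of `(0, 0)`, `(0, r)`, `(2, 0)`, `(3, r - 1)`,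
  -- the two chains give `a + b = a' + d` and `a' + b = a + d`, so `a = a'`.
  have h0 : IsFreeCorner P (0, r) ↔ IsFreeCorner P (0, 0) := by
    have e1 := hbmid.1.symm.trans hmid.1
    have e2 := hbmid.2.symm.trans hmid.2
    have e3 := hblast.1.symm.trans hlast.1
    have e4 := hblast.2.symm.trans hlast.2
    rw [← h1] at e1 e2
    rw [h3, h4, ← h2] at e3 e4
    clear hmid hlast hbmid hblast h1 h2 h3 h4
    grind
  have hall : ∀ k, k < r + ℓ →
      (IsFreeCorner P (0, k) ∧ IsFreeCorner P (2, k) ↔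
        IsFreeCorner P (0, 0) ∧ IsFreeCorner P (2, 0)) ∧
      (IsFreeCorner P (0, k) ∨ IsFreeCorner P (2, k) ↔
        IsFreeCorner P (0, 0) ∨ IsFreeCorner P (2, 0)) := fun k hk => by
    rcases lt_or_ge k r with hkr | hkr
    · exact hP.free_chain hr hℓ (by omega) hk (by omega)
    · have := hP.free_chain hr hℓ hkr hk (by omega)
      rwa [h0, h4] at this
  by_cases hand : IsFreeCorner P (0, 0) ∧ IsFreeCorner P (2, 0)
  · left
    rintro ⟨c, k⟩ hk
    have h02 := (hall k hk).1.2 hand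
    have h13 := (hP.free_balance hk).1.1 h02
    fin_cases c
    exacts [h02.1, h13.1, h02.2, h13.2]
  · by_cases hor : IsFreeCorner P (0, 0) ∨ IsFreeCorner P (2, 0)
    · right; right
      refine ⟨fun k hk => ?_, h0⟩
      obtain ⟨hb1, hb2⟩ := hP.free_balance hk
      have h02 := (hall k hk).2.2 hor
      have h02' := fun h => hand ((hall k hk).1.1 h)
      have h13 := hb2.1 h02
      have h13' := fun h => h02' (hb1.2 h)
      exact ⟨⟨fun h h' => h02' ⟨h', h⟩, h02.resolve_left⟩,
        ⟨fun h h' => h13' ⟨h', h⟩, h13.resolve_left⟩⟩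
    · right; left
      rintro ⟨c, k⟩ hk
      have h02 := not_or.1 fun h => hor ((hall k hk).2.1 h)
      have h13 := not_or.1 fun h => not_or.2 h02 ((hP.free_balance hk).2.2 h)
      fin_cases c
      exacts [h02.1, h13.1, h02.2, h13.2]

/-- In a four-cycle without free corners, two opposite edges are used. -/
theorem IsMatchingCode.of_not_free (hP : IsMatchingCode r ℓ P)
    (h : ∀ x : Fin 4 × ℕ, x.2 < r + ℓ → ¬ IsFreeCorner P x) {k : ℕ} (hk : k < r + ℓ) :
    (P 0 k ↔ ¬ P 1 k) ∧ (P 2 k ↔ ¬ P 1 k) ∧ (P 3 k ↔ P 1 k) := by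
  have h0 := h (0, k) hk
  have h1 := h (1, k) hk
  have h2 := h (2, k) hk
  have h3 := h (3, k) hk
  have h4 := hP.not_adjacent hk
  simp only [isFreeCorner_zero, isFreeCorner_one, isFreeCorner_two, isFreeCorner_three] at *
  tauto

/-! ### Connectivity of unions -/

/-- A matching with one edge between consecutive four-cycles and a disjoint one with none
have a connected union. -/
theorem IsMatchingCode.connected_of_one_free (hr : 0 < r) (hℓ : 0 < ℓ)
    (hP : IsMatchingCode r ℓ P) (hQ : IsMatchingCode r ℓ Q)
    (hone : ∀ k, k < r + ℓ → (IsFreeCorner P (2, k) ↔ ¬ IsFreeCorner P (0, k)) ∧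
        (IsFreeCorner P (3, k) ↔ ¬ IsFreeCorner P (1, k)))
    (hQfree : ∀ x : Fin 4 × ℕ, x.2 < r + ℓ → ¬ IsFreeCorner Q x)
    (hPQ : ∀ c k, k < r + ℓ → P c k → ¬ Q c k) {γ : Type*} {q : Fin 4 × ℕ → γ}
    (hint : ∀ c k, k < r + ℓ → P c k ∨ Q c k → q (c, k) = q (c + 1, k))
    (hext : ∀ x : Fin 4 × ℕ, x.2 < r + ℓ → IsFreeCorner P x → q x = q (papillonExt r ℓ x))
    (x : Fin 4 × ℕ) (hx : x.2 < r + ℓ) : q x = q (0, 0) := by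
  -- `Q` has two opposite edges here and `P` exactly one edge, not among them: together a path
  -- through all four corners.
  have hblock : ∀ k, k < r + ℓ →
      q (1, k) = q (0, k) ∧ q (2, k) = q (0, k) ∧ q (3, k) = q (0, k) := fun k hk => by
    have h0 : P 0 k ∨ Q 0 k → q (0, k) = q (1, k) := hint 0 k hk
    have h1 : P 1 k ∨ Q 1 k → q (1, k) = q (2, k) := hint 1 k hk
    have h2 : P 2 k ∨ Q 2 k → q (2, k) = q (3, k) := hint 2 k hk
    have h3 : P 3 k ∨ Q 3 k → q (3, k) = q (0, k) := hint 3 k hk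
    have hd0 := hPQ 0 k hk
    have hd1 := hPQ 1 k hk
    have hd2 := hPQ 2 k hk
    have hd3 := hPQ 3 k hk
    have hq := hQ.of_not_free hQfree hk
    have hp := hP.not_adjacent hk
    have ho := hone k hk
    simp only [isFreeCorner_zero, isFreeCorner_one, isFreeCorner_two, isFreeCorner_three] at ho
    grind
  have hchain : ∀ i k, i ≤ k → k < r + ℓ → (k < r ∨ r ≤ i) → q (0, k) = q (0, i) := by
    intro i k hik
    induction k, hik using Nat.le_induction with
    | base => exact fun _ _ => rfl
    | succ k hik ih =>
      intro hk hchain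
      rw [← ih (by omega) (by omega)]
      have h1 := hext (1, k) (by simp only; omega)
      have h3 := hext (3, k) (by simp only; omega)
      rw [papillonExt_one_of_lt hk] at h1
      rw [papillonExt_three_of_lt hk (by omega)] at h3
      have ho := hone k (by omega)
      have hb := hblock k (by omega)
      have hb' := hblock (k + 1) hk
      grind
  -- One of the corners 0, 2 of the first four-cycle is free, and its edge leads to the second
  -- chain: to its last four-cycle from 0, to its first from 2.
  have hjoin : q (0, r) = q (0, 0) := by
    have h2 := hext (2, 0) (by simp only; omega)
    have h0 := hext (0, 0) (by simp only; omega)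
    rw [papillonExt_two_first] at h2
    rw [papillonExt_zero, if_pos rfl] at h0
    have ho := hone 0 (by omega)
    have hb := hblock 0 (by omega)
    have hb' := hblock r (by omega)
    have hb'' := hblock (r + ℓ - 1) (by omega)
    have hc := hchain r (r + ℓ - 1) (by omega) (by omega) (by omega)
    grind
  have hzero : ∀ k, k < r + ℓ → q (0, k) = q (0, 0) := fun k hk => by
    rcases lt_or_ge k r with hkr | hkr
    · exact hchain 0 k (by omega) hk (by omega)
    · rw [hchain r k hkr hk (by omega), hjoin]
  obtain ⟨c, k⟩ := x
  have hb := hblock k hx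
  rw [← hzero k hx]
  fin_cases c
  exacts [rfl, hb.1, hb.2.1, hb.2.2]

open Classical in
/-- The number of the four-cycles `i ≤ j < k` in which `Q` uses the edges between `u` and `v`. -/
noncomputable def crossCount (Q : Fin 4 → ℕ → Prop) (i k : ℕ) : ℕ :=
  ((Finset.Ico i k).filter (Q 1)).card

theorem crossCount_self (i : ℕ) : crossCount Q i i = 0 := by
  simp [crossCount]

theorem crossCount_succ {i k : ℕ} (hik : i ≤ k) [Decidable (Q 1 k)] :
    crossCount Q i (k + 1) = crossCount Q i k + if Q 1 k then 1 else 0 := by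
  classical
  unfold crossCount
  rw [← Finset.insert_Ico_right_eq_Ico_add_one hik, Finset.filter_insert]
  split_ifs
  · rw [Finset.card_insert_of_notMem (by simp)]
  · rfl

/-- The matching of all edges between the four-cycles and one inside them have a connected union if
one of the two chains has an odd number of crossings. -/
theorem IsMatchingCode.connected_of_all_free (hr : 0 < r) (hℓ : 0 < ℓ)
    (hQ : IsMatchingCode r ℓ Q)
    (hQfree : ∀ x : Fin 4 × ℕ, x.2 < r + ℓ → ¬ IsFreeCorner Q x)
    (hodd : ¬ (Even (crossCount Q 0 r) ∧ Even (crossCount Q r (r + ℓ))))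
    {γ : Type*} {q : Fin 4 × ℕ → γ}
    (hint : ∀ c k, k < r + ℓ → Q c k → q (c, k) = q (c + 1, k))
    (hext : ∀ x : Fin 4 × ℕ, x.2 < r + ℓ → q x = q (papillonExt r ℓ x))
    (x : Fin 4 × ℕ) (hx : x.2 < r + ℓ) : q x = q (0, 0) := by
  classical
  have hblock : ∀ k, k < r + ℓ → if Q 1 k then q (1, k) = q (2, k) ∧ q (3, k) = q (0, k)
      else q (1, k) = q (0, k) ∧ q (3, k) = q (2, k) := fun k hk => by
    have h0 : Q 0 k → q (0, k) = q (1, k) := hint 0 k hk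
    have h1 : Q 1 k → q (1, k) = q (2, k) := hint 1 k hk
    have h2 : Q 2 k → q (2, k) = q (3, k) := hint 2 k hk
    have h3 : Q 3 k → q (3, k) = q (0, k) := hint 3 k hk
    have hq := hQ.of_not_free hQfree hk
    grind
  -- The strands entering at corners 0 and 2 of the four-cycle `i` leave the four-cycle `k` at
  -- corners 1 and 3, exchanged once per crossing.
  have hchain : ∀ i k, i ≤ k → k < r + ℓ → (k < r ∨ r ≤ i) →
      if Even (crossCount Q i (k + 1)) then q (1, k) = q (0, i) ∧ q (3, k) = q (2, i)
      else q (1, k) = q (2, i) ∧ q (3, k) = q (0, i) := by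
    intro i k hik
    induction k, hik using Nat.le_induction with
    | base =>
      intro hk _
      have hb := hblock i hk
      rw [crossCount_succ le_rfl, crossCount_self]
      split_ifs at hb ⊢ <;> simp_all
    | succ k hik ih =>
      intro hk hchain
      have ih := ih (by omega) (by omega)
      have h1 := hext (1, k) (by simp only; omega)
      have h3 := hext (3, k) (by simp only; omega)
      rw [papillonExt_one_of_lt hk] at h1
      rw [papillonExt_three_of_lt hk (by omega)] at h3
      have hb := hblock (k + 1) hk
      rw [crossCount_succ (k := k + 1) (by omega)]
      by_cases hc : Q 1 (k + 1) <;> by_cases he : Even (crossCount Q i (k + 1)) <;>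
        simp only [hc, he, if_true, if_false, add_zero, Nat.even_add_one, not_true_eq_false,
          not_false_eq_true] at hb ih ⊢ <;> grind
  have hmid := hchain 0 (r - 1) (by omega) (by omega) (by omega)
  have hlast := hchain r (r + ℓ - 1) (by omega) (by omega) (by omega)
  rw [Nat.sub_add_cancel hr] at hmid
  rw [Nat.sub_add_cancel (by omega)] at hlast
  have h1 := hext (1, r - 1) (by simp only; omega)
  have h2 := hext (1, r + ℓ - 1) (by simp only; omega)
  have h3 := hext (3, r - 1) (by simp only; omega)
  have h4 := hext (2, 0) (by simp only; omega)
  rw [papillonExt_one_of_lt (by omega), Nat.sub_add_cancel hr] at h1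
  rw [papillonExt_one_last hr] at h2
  rw [papillonExt_three_mid hr] at h3
  rw [papillonExt_two_first] at h4
  -- Only when both counts are even does the strand from `(0, 0)` return to it without meeting `(2,
  -- 0)`.
  have hends : q (2, 0) = q (0, 0) ∧ q (0, r) = q (0, 0) ∧ q (2, r) = q (0, 0) := by
    grind
  have hright : ∀ k, k < r + ℓ → q (1, k) = q (0, 0) ∧ q (3, k) = q (0, 0) := fun k hk => by
    rcases lt_or_ge k r with hkr | hkr
    · have := hchain 0 k (by omega) hk (by omega)
      grind
    · have := hchain r k hkr hk (by omega)
      grind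
  obtain ⟨c, k⟩ := x
  have hb := hblock k hx
  have hk := hright k hx
  fin_cases c <;> simp only [Fin.zero_eta, Fin.mk_one, Fin.reduceFinMk] <;> grind

end

/-! ### Construction of matchings -/

section

variable {r ℓ : ℕ}

/-- The edges inside the four-cycles of the perfect matching which uses the edges between `u` and
`v` in the four-cycles in `S`, and the edges between two `u`s and between two `v`s in the others. -/
def crossCode (S : ℕ → Prop) (c : Fin 4) (k : ℕ) : Prop :=
  match c with
  | 0 | 2 => ¬ S k
  | 1 | 3 => S k

theorem not_isFreeCorner_crossCode (S : ℕ → Prop) (x : Fin 4 × ℕ) :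
    ¬ IsFreeCorner (crossCode S) x := by
  obtain ⟨c, k⟩ := x
  fin_cases c <;>
    simp only [Fin.zero_eta, Fin.mk_one, Fin.reduceFinMk, isFreeCorner_zero, isFreeCorner_one,
      isFreeCorner_two, isFreeCorner_three, crossCode] <;> tauto

theorem isMatchingCode_crossCode (S : ℕ → Prop) : IsMatchingCode r ℓ (crossCode S) where
  disjoint c k _ h h' := by
    fin_cases c
    exacts [h h', h' h, h h', h' h]
  free_ext x _ h := absurd h (not_isFreeCorner_crossCode S x)

/-- This codes the matching of all edges between four-cycles. -/
theorem isMatchingCode_false : IsMatchingCode r ℓ fun _ _ => False where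
  disjoint _ _ _ h := h.elim
  free_ext _ _ _ := ⟨not_false, not_false⟩

/-- The edges inside the four-cycles of the perfect matching which has exactly one edge between
consecutive four-cycles, at corner `0` or `2` of the `k`-th one according to `α k`. -/
def strandCode (α : ℕ → Prop) (c : Fin 4) (k : ℕ) : Prop :=
  match c with
  | 0 => ¬ α k ∧ ¬ α (k + 1)
  | 1 => α k ∧ ¬ α (k + 1)
  | 2 => α k ∧ α (k + 1)
  | 3 => ¬ α k ∧ α (k + 1)

theorem isFreeCorner_strandCode (α : ℕ → Prop) (k : ℕ) :
    (IsFreeCorner (strandCode α) (0, k) ↔ α k) ∧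
    (IsFreeCorner (strandCode α) (1, k) ↔ α (k + 1)) ∧
    (IsFreeCorner (strandCode α) (2, k) ↔ ¬ α k) ∧
    (IsFreeCorner (strandCode α) (3, k) ↔ ¬ α (k + 1)) := by
  simp only [isFreeCorner_zero, isFreeCorner_one, isFreeCorner_two, isFreeCorner_three, strandCode]
  tauto

/-- With `α` true at `0`, `r` and `r + ℓ`, the chains are tied by the two edges between `u`s, and
the two special edges between `v`s stay unused. -/
theorem isMatchingCode_strandCode (hr : 0 < r) {α : ℕ → Prop} (h0 : α 0) (hmid : α r)
    (hlast : α (r + ℓ)) : IsMatchingCode r ℓ (strandCode α) where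
  disjoint c k _ h h' := by
    fin_cases c
    exacts [h.1 h'.1, h.2 h'.2, h'.1 h.1, h'.2 h.2]
  free_ext x hx h := by
    have hf := isFreeCorner_strandCode α
    obtain ⟨c, k⟩ := x
    simp only at hx
    fin_cases c <;> simp only [Fin.zero_eta, Fin.mk_one, Fin.reduceFinMk, papillonExt_zero,
      papillonExt_one, papillonExt_two, papillonExt_three, (hf _).1, (hf _).2.1, (hf _).2.2.1,
      (hf _).2.2.2] at h ⊢
    · split_ifs with h'
      · rwa [Nat.sub_add_cancel (by omega)]
      · rwa [Nat.sub_add_cancel (by omega)]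
    · split_ifs with h'
      · exact h0
      · exact h
    · split_ifs with h1 h2
      · exact absurd h0 (h1 ▸ h)
      · exact absurd hmid (h2 ▸ h)
      · rw [(hf _).2.2.2, Nat.sub_add_cancel (by omega)]
        exact h
    · split_ifs with h1 h2
      · exact absurd hmid (h1 ▸ h)
      · exact absurd hlast (h2 ▸ h)
      · rwa [(hf _).2.2.1]

theorem horizontalRel_inl_inl_iff {i j : Finset.Icc 1 (2 * r + 2 * ℓ)} :
    horizontalRel r ℓ (.inl i) (.inl j) ↔ (i : ℕ) % 2 = 1 ∧ (j : ℕ) = i + 1 := by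
  obtain ⟨i, hi⟩ := i
  obtain ⟨j, hj⟩ := j
  rw [Finset.mem_Icc] at hi hj
  simp only [horizontalRel, Finset.mem_Icc]
  refine ⟨?_, fun h => ⟨(i + 1) / 2, by omega, by omega, by omega⟩⟩
  rintro ⟨k, hk⟩
  omega

theorem horizontalRel_inr_inr_iff {i j : Finset.Icc 1 (2 * r + 2 * ℓ)} :
    horizontalRel r ℓ (.inr i) (.inr j) ↔ (i : ℕ) % 2 = 1 ∧ (j : ℕ) = i + 1 :=
  horizontalRel_inl_inl_iff (i := i) (j := j)

end

/-! ### Extending every perfect matching for even parameters -/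

section

variable {r ℓ : ℕ} [NeZero r]

theorem exists_hamiltonian_of_matchingCode (hrℓ : r < ℓ) {M : (papillonGraph r ℓ).Subgraph}
    (hM : M.IsPerfectMatching) {Q : Fin 4 → ℕ → Prop} (hQ : IsMatchingCode r ℓ Q)
    (hint : ∀ c k, k < r + ℓ → matchingCode M c k → ¬ Q c k)
    (hext : ∀ x : Fin 4 × ℕ, x.2 < r + ℓ → IsFreeCorner (matchingCode M) x → ¬ IsFreeCorner Q x)
    (hconn : ∀ (γ : Type) (q : Fin 4 × ℕ → γ),
      (∀ c k, k < r + ℓ → matchingCode M c k ∨ Q c k → q (c, k) = q (c + 1, k)) →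
      (∀ x : Fin 4 × ℕ, x.2 < r + ℓ → IsFreeCorner (matchingCode M) x ∨ IsFreeCorner Q x →
        q x = q (papillonExt r ℓ x)) →
      ∀ x : Fin 4 × ℕ, x.2 < r + ℓ → q x = q (0, 0)) :
    ∃ N : (papillonGraph r ℓ).Subgraph, N.IsPerfectMatching ∧ N ≠ M ∧
      (papillonGraph r ℓ).IsHamiltonianCycleEdgeSet (M.edgeSet ∪ N.edgeSet) := by
  obtain ⟨N, hN, hcode⟩ := hQ.exists_isPerfectMatching hrℓ
  have hfree : ∀ x : Fin 4 × ℕ, x.2 < r + ℓ →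
      (IsFreeCorner (matchingCode N) x ↔ IsFreeCorner Q x) := fun x hx =>
    isFreeCorner_congr hcode hx
  have hMN := not_adj_of_matchingCode hrℓ hM hN
    (fun c k hk h => by rw [hcode c k hk]; exact hint c k hk h)
    (fun x hx h => by rw [hfree x hx]; exact hext x hx h)
  have : Nonempty (PapillonVertex r ℓ) := ⟨papillonCorner r ℓ (0, 0)⟩
  refine ⟨N, hN, ?_, SimpleGraph.isHamiltonianCycleEdgeSet_union hM hN hMN
    (preconnected_of_matchingCode hrℓ hM hN fun γ q h1 h2 => hconn γ q ?_ ?_)⟩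
  · rintro rfl
    obtain ⟨w, hw, -⟩ := hM.1 (hM.2 (papillonCorner r ℓ (0, 0)))
    exact hMN _ _ hw hw
  · exact fun c k hk h => h1 c k hk (by rwa [hcode c k hk])
  · exact fun x hx h => h2 x hx (by rwa [hfree x hx])

theorem exists_hamiltonian_of_even (hrℓ : r < ℓ) (hre : Even r) (hℓe : Even ℓ)
    {M : (papillonGraph r ℓ).Subgraph} (hM : M.IsPerfectMatching) :
    ∃ N : (papillonGraph r ℓ).Subgraph, N.IsPerfectMatching ∧ N ≠ M ∧
      (papillonGraph r ℓ).IsHamiltonianCycleEdgeSet (M.edgeSet ∪ N.edgeSet) := by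
  classical
  have hr := NeZero.pos r
  have hℓ := hr.trans hrℓ
  have hP := isMatchingCode_matchingCode hrℓ hM
  set P := matchingCode M with hPdef
  rcases hP.trichotomy hr hℓ with hall | hnone | ⟨hone, -⟩
  · have hno : ∀ c k, k < r + ℓ → ¬ P c k := fun c k hk => (hall (c, k) hk).1
    -- A single crossing, in the first four-cycle, makes the first count odd.
    refine exists_hamiltonian_of_matchingCode hrℓ hM (isMatchingCode_crossCode fun k => k = 0)
      (fun c k hk h => absurd h (hno c k hk)) (fun x _ _ => not_isFreeCorner_crossCode _ x)
      fun γ q h1 h2 => (isMatchingCode_crossCode fun k => k = 0).connected_of_all_free hr hℓ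
        (fun x _ => not_isFreeCorner_crossCode _ x) ?_ (fun c k hk h => h1 c k hk (Or.inr h))
        fun x hx => h2 x hx (Or.inl (hall x hx))
    have h1 : crossCount (crossCode fun k => k = 0) 0 r = 1 := by
      rw [crossCount, Finset.card_eq_one]
      refine ⟨0, Finset.ext fun k => ?_⟩
      simp only [crossCode, Finset.mem_filter, Finset.mem_Ico, Finset.mem_singleton]
      omega
    rw [h1]
    simp
  · by_cases heven : Even (crossCount P 0 r) ∧ Even (crossCount P r (r + ℓ))
    -- Disjointness from `P` forces `α` to switch exactly at the four-cycles without a crossing; `k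
    -- + crossCount P 0 k` has the parity of their number below `k`. Evenness of `r` and `ℓ` makes
    -- `α` true at the chain ends.
    · let α : ℕ → Prop := fun k => Even (k + crossCount P 0 k)
      have hα : ∀ k, (α (k + 1) ↔ (α k ↔ P 1 k)) := fun k => by
        simp only [α, crossCount_succ (Nat.zero_le k)]
        by_cases hk : P 1 k <;> simp only [hk, if_true, if_false] <;> grind
      have h0 : α 0 := by simp [α, crossCount_self]
      have hmid : α r := hre.add heven.1
      have hlast : α (r + ℓ) := by
        have hadd : crossCount P 0 (r + ℓ) = crossCount P 0 r + crossCount P r (r + ℓ) := by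
          unfold crossCount
          rw [← Finset.card_union_of_disjoint, ← Finset.filter_union,
            Finset.Ico_union_Ico_eq_Ico (by omega) (by omega)]
          exact Finset.disjoint_filter_filter (Finset.Ico_disjoint_Ico_consecutive 0 r (r + ℓ))
        simp only [α, hadd]
        exact (hre.add hℓe).add (heven.1.add heven.2)
      have hQ := isMatchingCode_strandCode (ℓ := ℓ) hr h0 hmid hlast
      have hdisj : ∀ c k, k < r + ℓ → strandCode α c k → ¬ P c k := fun c k hk h h' => by
        have hp := hP.of_not_free hnone hk
        have ha := hα k
        fin_cases c <;> simp only [Fin.zero_eta, Fin.mk_one, Fin.reduceFinMk, strandCode] at h h' <;>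
          tauto
      refine exists_hamiltonian_of_matchingCode hrℓ hM hQ
        (fun c k hk h h' => hdisj c k hk h' h) (fun x hx h => absurd h (hnone x hx))
        fun γ q h1 h2 => hQ.connected_of_one_free hr hℓ hP (fun k _ => ?_) hnone hdisj
          (fun c k hk h => h1 c k hk h.symm) fun x hx h => h2 x hx (Or.inr h)
      have hf := isFreeCorner_strandCode α k
      rw [hf.1, hf.2.1, hf.2.2.1, hf.2.2.2]
      exact ⟨Iff.rfl, Iff.rfl⟩
    · exact exists_hamiltonian_of_matchingCode hrℓ hM isMatchingCode_false
        (fun _ _ _ _ h => h) (fun x hx h => absurd h (hnone x hx))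
        fun γ q h1 h2 => hP.connected_of_all_free hr hℓ hnone heven
          (fun c k hk h => h1 c k hk (Or.inl h))
          fun x hx => h2 x hx (Or.inr ⟨not_false, not_false⟩)
  -- In each four-cycle `Q` takes the opposite pair avoiding the single edge of `P`.
  · have hQ : IsMatchingCode r ℓ (crossCode fun k => P 0 k ∨ P 2 k) := isMatchingCode_crossCode _
    have hdisj : ∀ c k, k < r + ℓ → P c k → ¬ crossCode (fun k => P 0 k ∨ P 2 k) c k :=
      fun c k hk h h' => by
        have hp := hP.not_adjacent hk
        fin_cases c <;> simp only [Fin.zero_eta, Fin.mk_one, Fin.reduceFinMk, crossCode] at h h' <;>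
          tauto
    exact exists_hamiltonian_of_matchingCode hrℓ hM hQ hdisj
      (fun x _ _ => not_isFreeCorner_crossCode _ x)
      fun γ q h1 h2 => hP.connected_of_one_free hr hℓ hQ hone
        (fun x _ => not_isFreeCorner_crossCode _ x) hdisj h1
        fun x hx h => h2 x hx (Or.inl h)

/-! ### The horizontal matching and the parity obstruction -/

theorem horizontalMatching_adj_corner {x y : Fin 4 × ℕ} (hx : x.2 < r + ℓ) (hy : y.2 < r + ℓ) :
    (horizontalMatching r ℓ).Adj (papillonCorner r ℓ x) (papillonCorner r ℓ y) ↔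
      y = (![1, 0, 3, 2] x.1, x.2) := by
  obtain ⟨c, k⟩ := x
  obtain ⟨d, j⟩ := y
  simp only at hx hy
  have h1 : 2 * k + 1 ∈ Finset.Icc 1 (2 * r + 2 * ℓ) := by rw [Finset.mem_Icc]; omega
  have h2 : 2 * k + 2 ∈ Finset.Icc 1 (2 * r + 2 * ℓ) := by rw [Finset.mem_Icc]; omega
  have h3 : 2 * j + 1 ∈ Finset.Icc 1 (2 * r + 2 * ℓ) := by rw [Finset.mem_Icc]; omega
  have h4 : 2 * j + 2 ∈ Finset.Icc 1 (2 * r + 2 * ℓ) := by rw [Finset.mem_Icc]; omega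
  have hlr : ∀ i j : Finset.Icc 1 (2 * r + 2 * ℓ),
      horizontalRel r ℓ (.inl i) (.inr j) ↔ False := fun _ _ => Iff.rfl
  have hrl : ∀ i j : Finset.Icc 1 (2 * r + 2 * ℓ),
      horizontalRel r ℓ (.inr i) (.inl j) ↔ False := fun _ _ => Iff.rfl
  fin_cases c <;> fin_cases d <;>
    simp [horizontalMatching, papillonCorner, dif_pos h1, dif_pos h2, dif_pos h3, dif_pos h4,
      horizontalRel_inl_inl_iff, horizontalRel_inr_inr_iff, hlr, hrl, -Finset.mem_Icc] <;>
    omega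

theorem horizontalMatching_isPerfectMatching : (horizontalMatching r ℓ).IsPerfectMatching := by
  rw [SimpleGraph.Subgraph.isPerfectMatching_iff]
  intro v
  have hv := papillonCode_lt v
  rw [← papillonCorner_code v]
  refine ⟨papillonCorner r ℓ (![1, 0, 3, 2] (papillonCode r ℓ v).1, (papillonCode r ℓ v).2),
    (horizontalMatching_adj_corner hv (by exact hv)).2 rfl, fun w hw => ?_⟩
  have hw : (horizontalMatching r ℓ).Adj _ w := hw
  rw [← papillonCorner_code w, horizontalMatching_adj_corner hv (papillonCode_lt w)] at hw
  rw [← hw, papillonCorner_code]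

/-- The edges of a perfect matching, inside and between the four-cycles. -/
theorem eq_of_isPerfectMatching_adj (hrℓ : r < ℓ) {N : (papillonGraph r ℓ).Subgraph}
    (hN : N.IsPerfectMatching) {x y : Fin 4 × ℕ} (hx : x.2 < r + ℓ) (hy : y.2 < r + ℓ)
    (h : N.Adj (papillonCorner r ℓ x) (papillonCorner r ℓ y)) :
    y.2 = x.2 ∧ (matchingCode N x.1 x.2 ∨ matchingCode N (x.1 - 1) x.2) ∨
      y = papillonExt r ℓ x ∧ IsFreeCorner (matchingCode N) x := by
  obtain ⟨c, k⟩ := x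
  rcases (papillonGraph_adj_corner hrℓ hx hy).1 h.adj_sub with rfl | rfl | rfl
  · exact Or.inl ⟨rfl, Or.inl h⟩
  · refine Or.inl ⟨rfl, Or.inr ?_⟩
    rw [matchingCode, sub_add_cancel]
    exact h.symm
  · exact Or.inr ⟨rfl, (isFreeCorner_matchingCode_iff hrℓ hN hx).2 h⟩

theorem even_of_horizontalMatching_extends (hrℓ : r < ℓ)
    (h : (horizontalMatching r ℓ).ExtendsToHamiltonianCycle) : Even r ∧ Even ℓ := by
  have hr := NeZero.pos r
  have hℓ := hr.trans hrℓ
  obtain ⟨N, hN, hdisj, hconn⟩ :=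
    h.exists_isPerfectMatching horizontalMatching_isPerfectMatching
  have hQ := isMatchingCode_matchingCode hrℓ hN
  -- Connectivity as induction: a property of `(0, 0)` preserved by both matchings holds at every
  -- corner.
  have hstep : ∀ (S : Fin 4 × ℕ → Prop), S (0, 0) →
      (∀ c k, S (c, k) → S (![1, 0, 3, 2] c, k)) →
      (∀ x y : Fin 4 × ℕ, x.2 < r + ℓ → y.2 < r + ℓ →
        N.Adj (papillonCorner r ℓ x) (papillonCorner r ℓ y) → S x → S y) →
      ∀ x : Fin 4 × ℕ, x.2 < r + ℓ → S x := by
    intro S h0 hSM hSN x hx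
    rw [← papillonCode_corner hx]
    refine hconn.mem_of_adj_closed (S := fun v => S (papillonCode r ℓ v)) ?_
      (x := papillonCorner r ℓ (0, 0)) (by rwa [papillonCode_corner (by simp only; omega)]) _
    intro v w hvw hv
    have hvlt := papillonCode_lt v
    have hwlt := papillonCode_lt w
    rcases hvw with hvw | hvw <;>
      simp only [SimpleGraph.Subgraph.spanningCoe_adj] at hvw <;>
      rw [← papillonCorner_code v, ← papillonCorner_code w] at hvw
    · rw [horizontalMatching_adj_corner hvlt hwlt] at hvw
      rw [hvw]
      exact hSM _ _ hv
    · exact hSN _ _ hvlt hwlt hvw hv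
  rcases hQ.trichotomy hr hℓ with hall | hnone | ⟨hone, hr0⟩
  · exfalso
    -- If `N` takes all leaving edges, the `u`s are never left.
    have h2 := hstep (fun x => x.1 = 0 ∨ x.1 = 1) (Or.inl rfl) ?_ ?_ (2, 0) (by simp only; omega)
    · simp at h2
    · rintro c k (h | h) <;> simp only at h <;> subst h <;> simp
    · intro x y hx hy hxy hSx
      rcases eq_of_isPerfectMatching_adj hrℓ hN hx hy hxy with ⟨-, h' | h'⟩ | ⟨rfl, -⟩
      · exact absurd h' (hall x hx).1
      · exact absurd h' (hall x hx).2
      · obtain ⟨c, k⟩ := x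
        rcases hSx with h' | h' <;> simp only at h' <;> subst h' <;> simp [papillonExt]
  · exfalso
    -- If `N` takes no leaving edge, the first four-cycle is never left.
    have h2 := hstep (fun x => x.2 = 0) rfl (fun _ _ h => h) ?_ (0, 1) (by simp only; omega)
    · simp at h2
    · intro x y hx hy hxy hSx
      rcases eq_of_isPerfectMatching_adj hrℓ hN hx hy hxy with ⟨h', -⟩ | ⟨-, h'⟩
      · exact h'.trans hSx
      · exact absurd h' (hnone x hx)
  · have hno : ∀ c k, k < r + ℓ → c = 0 ∨ c = 2 → ¬ matchingCode N c k := by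
      intro c k hk hc
      refine hdisj _ _ ((horizontalMatching_adj_corner hk (by exact hk)).2 ?_)
      rcases hc with rfl | rfl <;> rfl
    -- `N` avoids the horizontal edges, so its one inner edge is a crossing edge and the strand
    -- switches in every four-cycle.
    have hflip : ∀ k, k < r + ℓ → (IsFreeCorner (matchingCode N) (1, k) ↔
        ¬ IsFreeCorner (matchingCode N) (0, k)) := fun k hk => by
      have h0 := hno 0 k hk (Or.inl rfl)
      have h2 := hno 2 k hk (Or.inr rfl)
      rw [← (hone k hk).1, isFreeCorner_one, isFreeCorner_two]
      tauto
    have hpar : ∀ k, k < r + ℓ → (IsFreeCorner (matchingCode N) (0, k) ↔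
        (IsFreeCorner (matchingCode N) (0, 0) ↔ Even k)) := by
      intro k
      induction k with
      | zero => simp
      | succ k ih =>
        intro hk
        have h1 := hQ.free_ext_iff hr hℓ (x := (1, k)) (by simp only; omega)
        rw [papillonExt_one_of_lt hk] at h1
        rw [h1, hflip k (by omega), ih (by omega), Nat.even_add_one]
        tauto
    have hre : Even r := by
      have := hpar r (by omega)
      tauto
    refine ⟨hre, ?_⟩
    -- Closing up from the last four-cycle to the first makes `r + ℓ` even.
    have h1 := hQ.free_ext_iff hr hℓ (x := (1, r + ℓ - 1)) (by simp only; omega)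
    rw [papillonExt_one_last hr, hflip _ (by omega), hpar (r + ℓ - 1) (by omega)] at h1
    have h2 : ¬ Even (r + ℓ - 1) := by tauto
    grind

end

theorem mainTheorem2 (r ℓ : ℕ) (hr : 0 < r) (hrℓ : r < ℓ) :
    ((papillonGraph r ℓ).IsPMH ↔ Even r ∧ Even ℓ) ∧
    (Odd r ∨ Odd ℓ →
      (horizontalMatching r ℓ).IsPerfectMatching ∧
      ¬ (horizontalMatching r ℓ).ExtendsToHamiltonianCycle) := by
  have : NeZero r := ⟨hr.ne'⟩
  have hM : (horizontalMatching r ℓ).IsPerfectMatching := horizontalMatching_isPerfectMatching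
  refine ⟨⟨fun h => ?_, fun h => ⟨⟨_, hM⟩, fun M hM => exists_hamiltonian_of_even hrℓ h.1 h.2 hM⟩⟩,
    fun hodd => ⟨hM, fun h => ?_⟩⟩
  · obtain ⟨N, -, -, hN⟩ := h.2 _ hM
    exact even_of_horizontalMatching_extends hrℓ ⟨_, hN, Set.subset_union_left⟩
  · obtain ⟨h1, h2⟩ := even_of_horizontalMatching_extends hrℓ h
    rw [← Nat.not_even_iff_odd, ← Nat.not_even_iff_odd] at hodd
    tauto
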